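/- Conventions. A (real) graded Fréchet space is a complete Hausdorff locally convex space $X$ whose topology is generated by a fixed sequence of seminorms with $\|x\|_k\le\|x\|_{k+1}$ for all $x\in X$, $k\in\mathbb N=\{0,1,2,\dots\}$. It is called standard if for every $x\in X$ there are a constant $c$, a sequence $(x_n)$ in $X$ converging to $x$ and nonnegative numbers $b_n$ such that $\|x_n\|_k\le c\,\|x\|_k$ for all $n,k\in\mathbb N$ and $\|x_n\|_k\le b_n^{\,k}$ for all $n\in\mathbb N$, $k\ge 1$. The space $C([-1,1],X)$ of continuous maps is graded by $\|z\|_k=\sup_{s\in[-1,1]}\|z(s)\|_k$. A function $g:X\to X$ defined near $x$ is Gâteaux differentiable at $x$ with derivative $Dg(x)$, a continuous linear map, if $\lim_{h\to0}h^{-1}(g(x+hu)-g(x))=Dg(x)u$ for all $u\in X$. A continuous map $f:S\to X$, $S=[t_0-r_0,t_0+r_0]\times U\subseteq\mathbb R\times X$, is of class $C^1$ with derivative $Df$ if for each $(t,x)\in S$ there is a continuous linear map $Df(t,x):\mathbb R\times X\to X$ with $\lim_{h\to 0}h^{-1}\big(f(t+h\tau,x+hu)-f(t,x)\big)=Df(t,x)(\tau,u)$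 for all $(\tau,u)\in\mathbb R\times X$ (the limit being over $h\neq0$ with $(t+h\tau,x+hu)\in S$), and $((t,x),(\tau,u))\mapsto Df(t,x)(\tau,u)$ is continuous on $S\times(\mathbb R\times X)$. Theorem 4.1. Let $X$ be a graded Fréchet space such that $X$ and $C([-1,1],X)$ are standard, let $U\subseteq X$ be open, $x_0\in U$, $t_0\in\mathbb R$, $r_0>0$, and let $f:[t_0-r_0,t_0+r_0]\times U\to X$ be continuous. Suppose that for each $t\in[t_0-r_0,t_0+r_0]$ the map $f(t,\cdot):U\to X$ is Gâteaux differentiable on $U$ with derivative $D_xf(t,\cdot)$, and that there is a non-decreasing sequence of nonnegative reals $(c_k)_{k\in\mathbb N}$ such that $$\|D_xf(t,x)u\|_k\le c_k\|u\|_k\qquad\text{for all }(t,x)\in[t_0-r_0,t_0+r_0]\times U,\ u\in X,\ k\in\mathbb N .$$ Then there is $r\in(0,r_0]$ such that the initial value problem $$x'(t)=f(t,x(t)),\quad t\in[t_0-r,t_0+r],\qquad x(t_0)=x_0,$$ has a solution $x\in C^1([t_0-r,t_0+r],X)$ with values in $U$ (with one-sided derivatives at the endpoints). If, in addition, $f$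 is of class $C^1$ on $[t_0-r_0,t_0+r_0]\times U$ and $\|Df(t,x)(\tau,u)\|_k\le c_k(|\tau|+\|u\|_k)$ for all $(t,x)\in[t_0-r_0,t_0+r_0]\times U$, $(\tau,u)\in\mathbb R\times X$, $k\in\mathbb N$, then the solution is unique: for every $r\in(0,r_0]$, any two $C^1$ solutions of the initial value problem on $[t_0-r,t_0+r]$ with values in $U$ coincide. -/

import Mathlib

open Set Filter Topology

/-- The topological vector space `X`, with the sequence `p 0 ≤ p 1 ≤ p 2 ≤ ⋯` of seminorms,
is a (real) graded Fréchet space: it is Hausdorff and complete, and its topology is generated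
by the seminorms. -/
structure IsGradedFrechet {X : Type*} [AddCommGroup X] [Module ℝ X] [UniformSpace X]
    [IsUniformAddGroup X] (p : ℕ → Seminorm ℝ X) : Prop where
  withSeminorms : WithSeminorms (𝕜 := ℝ) (E := X) p
  le_succ : ∀ (k : ℕ) (x : X), p k x ≤ p (k + 1) x
  t2 : T2Space X
  complete : CompleteSpace X

/-- The space `X` with the grading `p` is standard: every `x` is the limit of a sequence `(xₙ)`
with `p k xₙ ≤ c * p k x` for all `k` and `n`, and such that the seminorms of each `xₙ` grow at most
geometrically, `p k xₙ ≤ (bₙ) ^ k`. The geometric bound is asked for `k ≥ 1` only (for `k = 0`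
it would read `p 0 xₙ ≤ 1` and force `p 0 = 0`). -/
def IsStandard {X : Type*} [AddCommGroup X] [Module ℝ X] [TopologicalSpace X]
    (p : ℕ → Seminorm ℝ X) : Prop :=
  ∀ x : X, ∃ (c : ℝ) (y : ℕ → X) (b : ℕ → ℝ),
    Tendsto y atTop (𝓝 x) ∧ (∀ n, 0 ≤ b n) ∧
      (∀ n k, p k (y n) ≤ c * p k x) ∧ (∀ n k, 1 ≤ k → p k (y n) ≤ b n ^ k)

/-- The supremum seminorm `z ↦ sup_{s ∈ [-1, 1]} q (z s)` on `C([-1, 1], X)` attached to a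
seminorm `q` on `X`; see `pathSeminorm_apply`. -/
noncomputable def pathSeminorm {X : Type*} [AddCommGroup X] [Module ℝ X] [TopologicalSpace X]
    [IsTopologicalAddGroup X] [ContinuousSMul ℝ X] (q : Seminorm ℝ X) :
    Seminorm ℝ C(Icc (-1 : ℝ) 1, X) :=
  ⨆ s : Icc (-1 : ℝ) 1, q.comp (ContinuousMap.evalCLM ℝ s).toLinearMap

theorem pathSeminorm_apply {X : Type*} [AddCommGroup X] [Module ℝ X] [TopologicalSpace X]
    [IsTopologicalAddGroup X] [ContinuousSMul ℝ X] (q : Seminorm ℝ X) (hq : Continuous q)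
    (z : C(Icc (-1 : ℝ) 1, X)) :
    pathSeminorm q z = ⨆ s : Icc (-1 : ℝ) 1, q (z s) := by
  unfold pathSeminorm
  rw [Seminorm.iSup_apply]
  · rfl
  · rw [Seminorm.bddAbove_range_iff]
    intro z
    exact (isCompact_range (hq.comp z.continuous)).bddAbove

/-- `f'` is the Gâteaux derivative of `f` at `x`: for every direction `u`,
`(f (x + h u) - f x) / h → f' u` as `h → 0`. -/
def HasGateauxDerivAt {X Y : Type*} [AddCommGroup X] [Module ℝ X] [TopologicalSpace X]
    [AddCommGroup Y] [Module ℝ Y] [TopologicalSpace Y] [ContinuousSMul ℝ Y]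
    (f : X → Y) (f' : X →L[ℝ] Y) (x : X) : Prop :=
  ∀ u : X, HasDerivAt (fun h : ℝ => f (x + h • u)) (f' u) 0

/-- `f` is of class `C¹` on `S` with derivative `f'` (the usual notion between Fréchet spaces):
`f` is continuous on `S`, at each point `z` of `S` it has, within `S`, the directional
derivative `f' z v` in every direction `v`, and `(z, v) ↦ f' z v` is jointly continuous
for `z ∈ S`. -/
structure IsC1On {E Y : Type*} [AddCommGroup E] [Module ℝ E] [TopologicalSpace E]
    [AddCommGroup Y] [Module ℝ Y] [TopologicalSpace Y] [ContinuousSMul ℝ Y]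
    (f : E → Y) (f' : E → E →L[ℝ] Y) (S : Set E) : Prop where
  continuousOn : ContinuousOn f S
  hasDeriv : ∀ z ∈ S, ∀ v : E,
    HasDerivWithinAt (fun h : ℝ => f (z + h • v)) (f' z v) {h : ℝ | z + h • v ∈ S} 0
  continuousOn_deriv : ContinuousOn (fun q : E × E => f' q.1 q.2) (S ×ˢ univ)

/-- `x` is a `C¹` solution on `[t₀ - r, t₀ + r]`, with values in `U`, of `x' = f(t, x)`,
`x(t₀) = x₀`. Derivatives at the two endpoints are one-sided; values of `x` outside
`[t₀ - r, t₀ + r]` are irrelevant. -/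
structure IsC1Solution {X : Type*} [AddCommGroup X] [Module ℝ X] [TopologicalSpace X]
    [ContinuousSMul ℝ X] (f : ℝ × X → X) (U : Set X) (t₀ : ℝ) (x₀ : X) (r : ℝ)
    (x : ℝ → X) : Prop where
  mem : ∀ t ∈ Icc (t₀ - r) (t₀ + r), x t ∈ U
  hasDeriv : ∀ t ∈ Icc (t₀ - r) (t₀ + r),
    HasDerivWithinAt x (f (t, x t)) (Icc (t₀ - r) (t₀ + r)) t
  continuousOn : ContinuousOn x (Icc (t₀ - r) (t₀ + r))
  continuousOn_deriv : ContinuousOn (fun t => f (t, x t)) (Icc (t₀ - r) (t₀ + r))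
  initial : x t₀ = x₀

-- The bound on `Dxf` loses no derivatives: the same seminorm `p k` stands on both sides. By the
-- mean value inequality along segments, `f(t, ·)` is therefore `c k`-Lipschitz for every `p k` on
-- any convex subset of `U`, and Picard iteration works in all seminorms at once.
--
-- The length of the time interval is dictated by one seminorm only: some closed `p m`-ball around
-- `x₀` lies in `U`, and the iterates must stay in it. On this fixed interval the `n`-th step is
-- `O((c k * r) ^ n / n!)` in `p k`, which is summable however fast `c k` grows with `k`. For
-- uniqueness, two solutions that meet share a ball for a short time, where a Gronwall argument in
-- each `p k` makes them equal; connectedness of the interval does the rest.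
--
-- Calculus is done in the Banach completions of `(X, p k)`: the maps `toCompletion` turn `p k` into
-- a norm and jointly detect limits, derivatives and equality in `X`.

universe u

/-! ### Banach completions attached to the seminorms -/

section SeminormCompletion

variable {X : Type u} [AddCommGroup X] [Module ℝ X]

/-- The space `X`, normed by the seminorm `q`. -/
def SeminormedCopy (_q : Seminorm ℝ X) : Type u := X

noncomputable instance (q : Seminorm ℝ X) : SeminormedAddCommGroup (SeminormedCopy q) :=
  q.toAddGroupSeminorm.toSeminormedAddCommGroup

instance (q : Seminorm ℝ X) : Module ℝ (SeminormedCopy q) := inferInstanceAs (Module ℝ X)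

noncomputable instance (q : Seminorm ℝ X) : NormedSpace ℝ (SeminormedCopy q) where
  norm_smul_le := fun _ _ => (map_smul_eq_mul q _ _).le

end SeminormCompletion

theorem ContinuousLinearMap.hasDerivAtFilter_comp {X : Type*} [AddCommGroup X] [Module ℝ X]
    [TopologicalSpace X] [ContinuousSMul ℝ X] {Y : Type*} [NormedAddCommGroup Y]
    [NormedSpace ℝ Y] (π : X →L[ℝ] Y) {x : ℝ → X} {x' : X} {L : Filter (ℝ × ℝ)}
    (h : HasDerivAtFilter x x' L) : HasDerivAtFilter (fun t => π (x t)) (π x') L := by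
  refine .of_isLittleOTVS ?_
  refine ((π.isBigOTVS_comp).trans_isLittleOTVS h.isLittleOTVS).congr_left fun z => ?_
  simp

section WithSeminorms

variable {X : Type u} [AddCommGroup X] [Module ℝ X] [TopologicalSpace X]
  [IsTopologicalAddGroup X] {p : ℕ → Seminorm ℝ X}

/-- The canonical map of `X` to the Banach completion of `X` with respect to the seminorm `p k`. -/
noncomputable def WithSeminorms.toCompletion (hp : WithSeminorms p) (k : ℕ) :
    X →L[ℝ] UniformSpace.Completion (SeminormedCopy (p k)) where
  toLinearMap :=
    (UniformSpace.Completion.toComplₗᵢ (𝕜 := ℝ) (E := SeminormedCopy (p k))).toLinearMap ∘ₗ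
      { toFun := fun x => x, map_add' := fun _ _ => rfl, map_smul' := fun _ _ => rfl }
  cont := by
    refine continuous_of_continuousAt_zero (LinearMap.comp _ _) ?_
    rw [ContinuousAt, map_zero, tendsto_zero_iff_norm_tendsto_zero]
    refine ((hp.continuous_seminorm k).tendsto' 0 0 (map_zero _)).congr fun x => ?_
    exact (UniformSpace.Completion.norm_coe (E := SeminormedCopy (p k)) x).symm

theorem WithSeminorms.norm_toCompletion (hp : WithSeminorms p) (k : ℕ) (x : X) :
    ‖hp.toCompletion k x‖ = p k x :=
  UniformSpace.Completion.norm_coe (E := SeminormedCopy (p k)) x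

theorem WithSeminorms.tendsto_iff_toCompletion (hp : WithSeminorms p) {α : Type*} {u : α → X}
    {l : Filter α} {x : X} :
    Tendsto u l (𝓝 x) ↔ ∀ k, Tendsto (fun a => hp.toCompletion k (u a)) l
      (𝓝 (hp.toCompletion k x)) := by
  rw [hp.tendsto_nhds]
  refine forall_congr' fun k => ?_
  rw [Metric.tendsto_nhds]
  simp only [dist_eq_norm, ← map_sub, hp.norm_toCompletion]

theorem WithSeminorms.continuous_of_toCompletion (hp : WithSeminorms p) {α : Type*}
    [TopologicalSpace α] {u : α → X} (h : ∀ k, Continuous fun a => hp.toCompletion k (u a)) :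
    Continuous u :=
  continuous_iff_continuousAt.2 fun _ =>
    hp.tendsto_iff_toCompletion.2 fun k => (h k).continuousAt

theorem WithSeminorms.eq_of_toCompletion [T2Space X] (hp : WithSeminorms p) {x y : X}
    (h : ∀ k, hp.toCompletion k x = hp.toCompletion k y) : x = y := by
  by_contra hxy
  obtain ⟨k, hk⟩ := hp.separating_of_T1 (x - y) (sub_ne_zero.2 hxy)
  exact hk (by rw [← hp.norm_toCompletion, map_sub, h k, sub_self, norm_zero])

variable [ContinuousSMul ℝ X]

/-- Differentiability in `X` is convergence of difference quotients, which can be tested one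
seminorm at a time. -/
theorem WithSeminorms.hasDerivWithinAt_of_toCompletion (hp : WithSeminorms p) {x : ℝ → X}
    {x' : X} {s : Set ℝ} {t : ℝ}
    (h : ∀ k, HasDerivWithinAt (fun t => hp.toCompletion k (x t)) (hp.toCompletion k x') s t) :
    HasDerivWithinAt x x' s t := by
  refine .of_isLittleOTVS ?_
  rw [Asymptotics.isLittleOTVS_iff_tendsto_inv_smul
    (Eventually.of_forall fun z hz => by simp [sub_eq_zero.1 hz]), hp.tendsto_iff_toCompletion]
  intro k
  have := (h k).isLittleOTVS.tendsto_inv_smul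
  simpa using this

end WithSeminorms

section UniformSpace

variable {X : Type u} [AddCommGroup X] [Module ℝ X] [UniformSpace X]
  [IsUniformAddGroup X] {p : ℕ → Seminorm ℝ X}

theorem WithSeminorms.exists_tendsto_of_cauchySeq_toCompletion [CompleteSpace X]
    (hp : WithSeminorms p) {u : ℕ → X}
    (h : ∀ k, CauchySeq fun n => hp.toCompletion k (u n)) : ∃ x, Tendsto u atTop (𝓝 x) := by
  refine cauchySeq_tendsto_of_complete ?_
  rw [cauchySeq_iff_tendsto, uniformity_eq_comap_nhds_zero, tendsto_comap_iff,
    hp.tendsto_iff_toCompletion]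
  intro k
  have := h k
  rw [cauchySeq_iff_tendsto, uniformity_eq_comap_nhds_zero, tendsto_comap_iff] at this
  rw [map_zero]
  refine this.congr fun z => ?_
  simp

end UniformSpace

/-! ### Integration of continuous curves in `X` -/

section RiemannSum

variable {X : Type u} [AddCommGroup X] [Module ℝ X]

/-- The left Riemann sum of `g` on `[a, b]` with `n` equal steps. -/
noncomputable def leftRiemannSum (g : ℝ → X) (a b : ℝ) (n : ℕ) : X :=
  ∑ i ∈ Finset.range n, ((b - a) / n) • g (a + i * ((b - a) / n))

theorem tendsto_leftRiemannSum {Y : Type*} [NormedAddCommGroup Y] [NormedSpace ℝ Y]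
    [CompleteSpace Y] {g : ℝ → Y} (hg : Continuous g) (a b : ℝ) :
    Tendsto (leftRiemannSum g a b) atTop (𝓝 (∫ t in a..b, g t)) := by
  have huc : UniformContinuousOn g (uIcc a b) :=
    isCompact_uIcc.uniformContinuousOn_of_continuous hg.continuousOn
  rw [Metric.tendsto_atTop]
  intro ε hε
  -- The cell errors add up to at most `ε * |b - a| / (|b - a| + 1) < ε`; the `+ 1` also covers `a =
  -- b`.
  obtain ⟨δ, hδ, h⟩ := Metric.uniformContinuousOn_iff.1 huc (ε / (|b - a| + 1)) (by positivity)
  obtain ⟨N, hN⟩ := exists_nat_gt (|b - a| / δ)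
  refine ⟨N + 1, fun n hn => ?_⟩
  have hn0 : (0 : ℝ) < n := by exact_mod_cast (by omega : 0 < n)
  have hmesh : |(b - a) / n| < δ := by
    rw [abs_div, abs_of_pos hn0, div_lt_iff₀ hn0]
    rw [div_lt_iff₀ hδ] at hN
    have : (N : ℝ) < n := by exact_mod_cast hn
    nlinarith
  set d := (b - a) / n with hd
  have hnd : n * d = b - a := by rw [hd]; field_simp
  have hmem : ∀ θ ∈ Icc (0 : ℝ) n, a + θ * d ∈ uIcc a b := by
    intro θ hθ
    rw [← segment_eq_uIcc, segment_eq_image']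
    refine ⟨θ / n, ⟨div_nonneg hθ.1 hn0.le, (div_le_one hn0).2 hθ.2⟩, ?_⟩
    simp only [smul_eq_mul, ← hnd]
    field_simp
  have h_split : ∫ t in a..b, g t
      = ∑ i ∈ Finset.range n, ∫ t in (a + i * d)..(a + (i + 1 : ℕ) * d), g t := by
    rw [intervalIntegral.sum_integral_adjacent_intervals
      (a := fun i : ℕ => a + i * d) fun k _ => hg.intervalIntegrable _ _]
    simp [hnd]
  have hstep : ∀ i ∈ Finset.range n, ‖d • g (a + i * d)
      - ∫ t in (a + i * d)..(a + (i + 1 : ℕ) * d), g t‖ ≤ ε / (|b - a| + 1) * |d| := by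
    intro i hi
    have hi' : (i : ℝ) + 1 ≤ n := by exact_mod_cast Finset.mem_range.1 hi
    have hi0 : (0 : ℝ) ≤ i := i.cast_nonneg
    have hlen : a + (i + 1 : ℕ) * d - (a + i * d) = d := by push_cast; ring
    have hconst : d • g (a + i * d)
        = ∫ _ in (a + i * d)..(a + (i + 1 : ℕ) * d), g (a + i * d) := by
      rw [intervalIntegral.integral_const, hlen]
    rw [hconst, ← intervalIntegral.integral_sub (by simp) (hg.intervalIntegrable _ _)]
    conv_rhs => rw [← hlen]
    refine intervalIntegral.norm_integral_le_of_norm_le_const fun t ht => ?_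
    have ht' := uIoc_subset_uIcc ht
    rw [← segment_eq_uIcc, segment_eq_image'] at ht'
    obtain ⟨θ, hθ, rfl⟩ := ht'
    beta_reduce
    rw [hlen, smul_eq_mul, add_assoc, ← add_mul, ← dist_eq_norm]
    refine (h _ (hmem i ⟨hi0, by linarith⟩) _
      (hmem _ ⟨by linarith [hθ.1], by linarith [hθ.2]⟩) ?_).le
    rw [Real.dist_eq, show a + i * d - (a + (i + θ) * d) = -(θ * d) by ring, abs_neg, abs_mul,
      abs_of_nonneg hθ.1]
    exact (mul_le_of_le_one_left (abs_nonneg _) hθ.2).trans_lt hmesh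
  rw [dist_eq_norm, h_split, leftRiemannSum, ← Finset.sum_sub_distrib]
  refine (norm_sum_le_of_le _ hstep).trans_lt ?_
  rw [Finset.sum_const, Finset.card_range, nsmul_eq_mul, mul_left_comm,
    show (n : ℝ) * |d| = |b - a| by rw [← hnd, abs_mul, abs_of_pos hn0],
    div_mul_eq_mul_div, div_lt_iff₀ (by positivity)]
  nlinarith

end RiemannSum

section Integral

theorem map_leftRiemannSum {X Y : Type*} [AddCommGroup X] [Module ℝ X]
    [TopologicalSpace X] [AddCommGroup Y] [Module ℝ Y] [TopologicalSpace Y]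
    (π : X →L[ℝ] Y) (g : ℝ → X) (a b : ℝ) (n : ℕ) :
    π (leftRiemannSum g a b n) = leftRiemannSum (fun t => π (g t)) a b n := by
  simp [leftRiemannSum]

variable {X : Type u} [AddCommGroup X] [Module ℝ X] [UniformSpace X]
  [IsUniformAddGroup X] {p : ℕ → Seminorm ℝ X}

/-- The integral of `g` from `a` to `b`, as the limit of Riemann sums. -/
noncomputable def riemannIntegral (g : ℝ → X) (a b : ℝ) : X :=
  limUnder atTop (leftRiemannSum g a b)

/-- The Riemann sums lie in `X` and are Cauchy in every completion, so completeness of `X` puts the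
integral in `X` rather than only in the completions. -/
theorem WithSeminorms.toCompletion_riemannIntegral [CompleteSpace X]
    (hp : WithSeminorms p) {g : ℝ → X} (hg : Continuous g) (a b : ℝ) (k : ℕ) :
    hp.toCompletion k (riemannIntegral g a b) = ∫ t in a..b, hp.toCompletion k (g t) := by
  have h : ∀ k, Tendsto (fun n => hp.toCompletion k (leftRiemannSum g a b n)) atTop
      (𝓝 (∫ t in a..b, hp.toCompletion k (g t))) := fun k => by
    simp only [map_leftRiemannSum]
    exact tendsto_leftRiemannSum ((hp.toCompletion k).continuous.comp hg) a b
  have hlim := tendsto_nhds_limUnder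
    (hp.exists_tendsto_of_cauchySeq_toCompletion fun k => (h k).cauchySeq)
  exact tendsto_nhds_unique (((hp.toCompletion k).continuous.tendsto _).comp hlim) (h k)

theorem WithSeminorms.toCompletion_riemannIntegral_sub [CompleteSpace X]
    (hp : WithSeminorms p) {g h : ℝ → X} (hg : Continuous g) (hh : Continuous h) (a b : ℝ)
    (k : ℕ) : hp.toCompletion k (riemannIntegral g a b) - hp.toCompletion k (riemannIntegral h a b)
      = ∫ t in a..b, hp.toCompletion k (g t - h t) := by
  simp only [hp.toCompletion_riemannIntegral hg, hp.toCompletion_riemannIntegral hh, map_sub]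
  exact (intervalIntegral.integral_sub
    (((hp.toCompletion k).continuous.comp hg).intervalIntegrable _ _)
    (((hp.toCompletion k).continuous.comp hh).intervalIntegrable _ _)).symm

theorem WithSeminorms.seminorm_riemannIntegral_le [CompleteSpace X]
    (hp : WithSeminorms p) {g : ℝ → X} (hg : Continuous g) {a b C : ℝ} {k : ℕ}
    (h : ∀ t ∈ uIoc a b, p k (g t) ≤ C) : p k (riemannIntegral g a b) ≤ C * |b - a| := by
  rw [← hp.norm_toCompletion, hp.toCompletion_riemannIntegral hg]
  exact intervalIntegral.norm_integral_le_of_norm_le_const fun t ht => by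
    rw [hp.norm_toCompletion]; exact h t ht

theorem WithSeminorms.continuous_riemannIntegral [CompleteSpace X]
    (hp : WithSeminorms p) {g : ℝ → X} (hg : Continuous g) (a : ℝ) :
    Continuous (riemannIntegral g a) := by
  refine hp.continuous_of_toCompletion fun k => ?_
  simp only [hp.toCompletion_riemannIntegral hg]
  exact intervalIntegral.continuous_primitive
    (fun _ _ => ((hp.toCompletion k).continuous.comp hg).intervalIntegrable _ _) a

theorem WithSeminorms.hasDerivWithinAt_of_eqOn_riemannIntegral [CompleteSpace X]
    [ContinuousSMul ℝ X] (hp : WithSeminorms p) {g x : ℝ → X} (hg : Continuous g) {x₀ : X}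
    {a t : ℝ} {s : Set ℝ} (hx : EqOn x (fun t => x₀ + riemannIntegral g a t) s) (ht : t ∈ s) :
    HasDerivWithinAt x (g t) s t := by
  refine hp.hasDerivWithinAt_of_toCompletion fun k => ?_
  have hc := (hp.toCompletion k).continuous.comp hg
  refine ((intervalIntegral.integral_hasDerivAt_right (hc.intervalIntegrable a t)
    hc.stronglyMeasurable.stronglyMeasurableAtFilter
    hc.continuousAt).hasDerivWithinAt.const_add (hp.toCompletion k x₀)).congr_of_mem
    (fun τ hτ => ?_) ht
  rw [hx hτ, map_add, hp.toCompletion_riemannIntegral hg]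
  rfl

end Integral

/-! ### Picard iteration in all seminorms simultaneously -/

section Picard

variable {X : Type u} [AddCommGroup X] [Module ℝ X] [UniformSpace X]
  [IsUniformAddGroup X] {p : ℕ → Seminorm ℝ X}

/-- One step of the error estimate for Picard iterates. -/
theorem norm_integral_le_pow_div_factorial {Y : Type*} [NormedAddCommGroup Y] [NormedSpace ℝ Y]
    {h : ℝ → Y} {A C a b : ℝ} {n : ℕ}
    (hh : ∀ s ∈ uIoc a b, ‖h s‖ ≤ C * (A * (C * |s - a|) ^ n / n.factorial)) :
    ‖∫ s in a..b, h s‖ ≤ A * (C * |b - a|) ^ (n + 1) / (n + 1).factorial := by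
  set D := C * A * C ^ n / n.factorial
  have hD : ∀ s, C * (A * (C * |s - a|) ^ n / n.factorial) = D * |s - a| ^ n := fun s => by
    simp only [D, mul_pow]; ring
  have h_split : IntervalIntegrable (fun s => D * |s - a| ^ n) MeasureTheory.volume a b :=
    Continuous.intervalIntegrable (by fun_prop) _ _
  refine (intervalIntegral.norm_integral_le_integral_norm_uIoc).trans ?_
  refine (MeasureTheory.integral_mono_of_nonneg (Eventually.of_forall fun _ => norm_nonneg _)
    h_split.def' ?_).trans_eq ?_
  · filter_upwards [MeasureTheory.ae_restrict_mem measurableSet_uIoc] with s hs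
    exact (hh s hs).trans_eq (hD s)
  · rw [MeasureTheory.integral_const_mul, integral_pow_abs_sub_uIoc, Nat.factorial_succ]
    simp only [D]
    push_cast
    field_simp
    ring

/-- The factorial bound on successive Picard iterates is summable for every `C k`, so `r` need not
be small relative to the Lipschitz constants; only invariance of `B` is required. -/
theorem WithSeminorms.exists_eq_add_riemannIntegral [CompleteSpace X] [T2Space X]
    (hp : WithSeminorms p) {F : ℝ → X → X} {B : Set X} (hB : IsClosed B)
    (hF : ContinuousOn (fun z : ℝ × X => F z.1 z.2) (univ ×ˢ B)) {C : ℕ → ℝ}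
    (hLip : ∀ k t, ∀ x ∈ B, ∀ y ∈ B, p k (F t x - F t y) ≤ C k * p k (x - y))
    {x₀ : X} (hx₀ : x₀ ∈ B) {t₀ r : ℝ} (hr : 0 ≤ r) (hC : ∀ k, 0 ≤ C k)
    (hmaps : ∀ z : ℝ → X, Continuous z → (∀ t, z t ∈ B) → ∀ t ∈ Icc (t₀ - r) (t₀ + r),
      x₀ + riemannIntegral (fun s => F s (z s)) t₀ t ∈ B) :
    ∃ x : ℝ → X, Continuous x ∧ (∀ t, x t ∈ B) ∧ ∀ t ∈ Icc (t₀ - r) (t₀ + r),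
      x t = x₀ + riemannIntegral (fun s => F s (x s)) t₀ t := by
  have hle : t₀ - r ≤ t₀ + r := by linarith
  -- Clamping time to the interval makes every iterate a continuous curve on all of `ℝ`.
  set γ : ℝ → ℝ := fun t => projIcc (t₀ - r) (t₀ + r) hle t with hγ
  have hγc : Continuous γ := continuous_subtype_val.comp continuous_projIcc
  have hγmem : ∀ t, γ t ∈ Icc (t₀ - r) (t₀ + r) := fun t => (projIcc _ _ hle t).2
  have hγid : ∀ t ∈ Icc (t₀ - r) (t₀ + r), γ t = t := fun t ht =>
    congrArg Subtype.val (projIcc_of_mem hle ht)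
  have hγabs : ∀ t, |γ t - t₀| ≤ r := fun t => abs_le.2
    ⟨by linarith [(hγmem t).1], by linarith [(hγmem t).2]⟩
  have hsub : ∀ t, ∀ s ∈ uIoc t₀ (γ t), s ∈ Icc (t₀ - r) (t₀ + r) := fun t s hs =>
    uIcc_subset_Icc ⟨by linarith, by linarith⟩ (hγmem t) (uIoc_subset_uIcc hs)
  have hcont : ∀ z : ℝ → X, Continuous z → (∀ t, z t ∈ B) → Continuous fun s => F s (z s) :=
    fun z hz hzB => hF.comp_continuous (continuous_id.prodMk hz) fun t => ⟨mem_univ _, hzB t⟩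
  let Φ : {z : ℝ → X // Continuous z ∧ ∀ t, z t ∈ B} → {z : ℝ → X // Continuous z ∧ ∀ t, z t ∈ B} :=
    fun z => ⟨fun t => x₀ + riemannIntegral (fun s => F s (z.1 s)) t₀ (γ t),
      continuous_const.add ((hp.continuous_riemannIntegral (hcont _ z.2.1 z.2.2) t₀).comp hγc),
      fun t => hmaps z.1 z.2.1 z.2.2 _ (hγmem t)⟩
  let u : ℕ → {z : ℝ → X // Continuous z ∧ ∀ t, z t ∈ B} :=
    fun n => Φ^[n] ⟨fun _ => x₀, continuous_const, fun _ => hx₀⟩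
  have hu : ∀ n t, (u (n + 1)).1 t
      = x₀ + riemannIntegral (fun s => F s ((u n).1 s)) t₀ (γ t) := fun n t => by
    simp only [u, Function.iterate_succ_apply']; rfl
  have hFu := fun n => hcont _ (u n).2.1 (u n).2.2
  have hstep : ∀ k, ∃ A, ∀ n t, ‖hp.toCompletion k ((u n).1 t)
      - hp.toCompletion k ((u (n + 1)).1 t)‖ ≤ A * (C k * |γ t - t₀|) ^ n / n.factorial := by
    intro k
    obtain ⟨M, hM⟩ := (isCompact_Icc (a := t₀ - r) (b := t₀ + r)).exists_bound_of_continuousOn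
      (f := fun s => hp.toCompletion k ((u 0).1 s) - hp.toCompletion k ((u 1).1 s))
      (((hp.toCompletion k).continuous.comp (u 0).2.1).sub
        ((hp.toCompletion k).continuous.comp (u 1).2.1)).continuousOn
    refine ⟨M, fun n => ?_⟩
    induction n with
    | zero =>
      intro t
      -- The iterate `u 0` is constant and `u 1` depends on `t` only through `γ t`, so the bound on
      -- the compact interval holds for all `t`.
      have h0 : (u 1).1 t = (u 1).1 (γ t) := by rw [hu, hu, hγid _ (hγmem t)]
      have := hM (γ t) (hγmem t)
      rw [← h0] at this
      simpa using! this
    | succ n ih =>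
      intro t
      rw [hu, hu, map_add, map_add, add_sub_add_left_eq_sub,
        hp.toCompletion_riemannIntegral_sub (hFu n) (hFu (n + 1))]
      refine norm_integral_le_pow_div_factorial fun s hs => ?_
      rw [hp.norm_toCompletion]
      refine (hLip k s _ ((u n).2.2 s) _ ((u (n + 1)).2.2 s)).trans
        (mul_le_mul_of_nonneg_left ?_ (hC k))
      have := ih s
      rwa [hγid s (hsub t s hs), ← map_sub, hp.norm_toCompletion] at this
  choose A hA using hstep
  have hA0 : ∀ k, 0 ≤ A k := fun k => by simpa using (norm_nonneg _).trans (hA k 0 t₀)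
  have hdist : ∀ k t n, dist (hp.toCompletion k ((u n).1 t))
      (hp.toCompletion k ((u (n + 1)).1 t)) ≤ A k * ((C k * r) ^ n / n.factorial) := by
    intro k t n
    rw [dist_eq_norm, ← mul_div_assoc]
    refine (hA k n t).trans ?_
    have := hA0 k
    have := hC k
    gcongr
    exact hγabs t
  have hsum : ∀ k, Summable fun n : ℕ => A k * ((C k * r) ^ n / n.factorial) := fun k =>
    (Real.summable_pow_div_factorial _).mul_left _
  have hex : ∀ t, ∃ x, Tendsto (fun n => (u n).1 t) atTop (𝓝 x) := fun t =>
    hp.exists_tendsto_of_cauchySeq_toCompletion fun k =>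
      cauchySeq_of_dist_le_of_summable _ (hdist k t) (hsum k)
  choose x hx using hex
  have hπx := fun k t => ((hp.toCompletion k).continuous.tendsto _).comp (hx t)
  -- Tails of the majorant series: an error bound uniform in `t`.
  set e : ℕ → ℕ → ℝ := fun k n => ∑' m, A k * ((C k * r) ^ (n + m) / (n + m).factorial) with he
  have hex : ∀ k n t, dist (hp.toCompletion k ((u n).1 t)) (hp.toCompletion k (x t)) ≤ e k n :=
    fun k n t => dist_le_tsum_of_dist_le_of_tendsto _ (hdist k t) (hsum k) (hπx k t) n
  have he0 : ∀ k, Tendsto (e k) atTop (𝓝 0) := fun k => by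
    simpa only [he, add_comm] using
      tendsto_sum_nat_add fun n : ℕ => A k * ((C k * r) ^ n / n.factorial)
  have hxB : ∀ t, x t ∈ B := fun t =>
    hB.mem_of_tendsto (hx t) (Eventually.of_forall fun n => (u n).2.2 t)
  have hxc : Continuous x := by
    refine hp.continuous_of_toCompletion fun k => ?_
    refine TendstoUniformly.continuous (p := atTop)
      (F := fun n t => hp.toCompletion k ((u n).1 t)) ?_
      (Frequently.of_forall fun n => (hp.toCompletion k).continuous.comp (u n).2.1)
    rw [Metric.tendstoUniformly_iff]
    intro ε hε
    filter_upwards [(he0 k).eventually_lt_const hε] with n hn t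
    rw [dist_comm]
    exact (hex k n t).trans_lt hn
  refine ⟨x, hxc, hxB, fun t ht => hp.eq_of_toCompletion fun k => ?_⟩
  have hFx := hcont x hxc hxB
  have hlim : Tendsto (fun n => hp.toCompletion k ((u (n + 1)).1 t)) atTop
      (𝓝 (hp.toCompletion k (x₀ + riemannIntegral (fun s => F s (x s)) t₀ t))) := by
    rw [tendsto_iff_dist_tendsto_zero]
    refine squeeze_zero (fun _ => dist_nonneg) (fun n => ?_)
      (g := fun n => C k * e k n * |t - t₀|) (by simpa using ((he0 k).const_mul _).mul_const _)
    rw [hu, hγid t ht, dist_eq_norm, map_add, map_add, add_sub_add_left_eq_sub,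
      hp.toCompletion_riemannIntegral_sub (hFu n) hFx]
    refine intervalIntegral.norm_integral_le_of_norm_le_const fun s _ => ?_
    rw [hp.norm_toCompletion]
    refine (hLip k s _ ((u n).2.2 s) _ (hxB s)).trans (mul_le_mul_of_nonneg_left ?_ (hC k))
    rw [← hp.norm_toCompletion, map_sub, ← dist_eq_norm]
    exact hex k n s
  exact tendsto_nhds_unique ((hπx k t).comp (tendsto_add_atTop_nat 1)) hlim

end Picard

/-! ### Lipschitz estimate, existence and uniqueness -/

section ODE

variable {X : Type u} [AddCommGroup X] [Module ℝ X] [UniformSpace X]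
  [IsUniformAddGroup X] {p : ℕ → Seminorm ℝ X}

theorem IsGradedFrechet.exists_closedBall_subset (hX : IsGradedFrechet p) {x : X} {U : Set X}
    (hU : U ∈ 𝓝 x) : ∃ m, ∃ ε > 0, (p m).closedBall x ε ⊆ U := by
  obtain ⟨s, ε, hε, h⟩ := (hX.withSeminorms.mem_nhds_iff x U).1 hU
  have hmono : Monotone p := monotone_nat_of_le_succ fun k => hX.le_succ k
  -- As the grading is increasing, the largest index in `s` dominates the finite supremum; halving
  -- `ε` fits a closed ball into the open one.
  refine ⟨s.sup id, ε / 2, by positivity, fun z hz => h ?_⟩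
  rw [Seminorm.mem_closedBall] at hz
  rw [Seminorm.mem_ball]
  have hle : s.sup p ≤ p (s.sup id) :=
    Finset.sup_le fun i hi => hmono (Finset.le_sup (f := id) hi)
  exact ((hle _).trans hz).trans_lt (by linarith)

variable [ContinuousSMul ℝ X]

theorem WithSeminorms.seminorm_sub_le_of_hasGateauxDerivAt (hp : WithSeminorms p) {f : X → X}
    {f' : X → X →L[ℝ] X} {B : Set X} (hB : Convex ℝ B) {k : ℕ} {C : ℝ}
    (hf : ∀ z ∈ B, HasGateauxDerivAt f (f' z) z)
    (hbound : ∀ z ∈ B, ∀ u, p k (f' z u) ≤ C * p k u) {x y : X} (hx : x ∈ B) (hy : y ∈ B) :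
    p k (f x - f y) ≤ C * p k (x - y) := by
  have hmem : ∀ s ∈ Icc (0 : ℝ) 1, y + s • (x - y) ∈ B := fun s hs =>
    hB.add_smul_sub_mem hy hx hs
  have hderiv : ∀ s ∈ Icc (0 : ℝ) 1, HasDerivWithinAt
      (fun s => hp.toCompletion k (f (y + s • (x - y))))
      (hp.toCompletion k (f' (y + s • (x - y)) (x - y))) (Icc 0 1) s := fun s hs => by
    have h : HasDerivAt _ _ _ :=
      (hp.toCompletion k).hasDerivAtFilter_comp (hf _ (hmem s hs) (x - y))
    -- The Gâteaux derivative is taken at parameter `0`; writing `0 = s - s` moves it to `s`.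
    rw [← sub_self s] at h
    refine (h.comp_sub_const s s).hasDerivWithinAt.congr_of_mem (fun τ _ => ?_) hs
    rw [sub_smul]
    congr 2
    abel
  have := norm_image_sub_le_of_norm_deriv_le_segment_01' hderiv (C := C * p k (x - y))
    fun s hs => by
      rw [hp.norm_toCompletion]
      exact hbound _ (hmem s ⟨hs.1, hs.2.le⟩) _
  simpa [← map_sub, hp.norm_toCompletion] using this

theorem IsGradedFrechet.exists_isC1Solution (hX : IsGradedFrechet p) {U : Set X} (hU : IsOpen U)
    {x₀ : X} (hx₀ : x₀ ∈ U) {t₀ r₀ : ℝ} (hr₀ : 0 < r₀) {f : ℝ × X → X}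
    (hf : ContinuousOn f (Icc (t₀ - r₀) (t₀ + r₀) ×ˢ U)) {Dxf : ℝ → X → X →L[ℝ] X}
    (hDxf : ∀ t ∈ Icc (t₀ - r₀) (t₀ + r₀), ∀ x ∈ U,
      HasGateauxDerivAt (fun y => f (t, y)) (Dxf t x) x)
    {c : ℕ → ℝ} (hc : ∀ k, 0 ≤ c k)
    (hbound : ∀ t ∈ Icc (t₀ - r₀) (t₀ + r₀), ∀ x ∈ U, ∀ (u : X) (k : ℕ),
      p k (Dxf t x u) ≤ c k * p k u) :
    ∃ r : ℝ, 0 < r ∧ r ≤ r₀ ∧ ∃ x : ℝ → X, IsC1Solution f U t₀ x₀ r x := by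
  have hp := hX.withSeminorms
  have := hX.t2
  have := hX.complete
  obtain ⟨m, ε, hε, hBU⟩ := hX.exists_closedBall_subset (hU.mem_nhds hx₀)
  set B := (p m).closedBall x₀ ε with hBdef
  have hBconv : Convex ℝ B := Seminorm.convex_closedBall _ _ _
  have hx₀B : x₀ ∈ B := by rw [hBdef, Seminorm.mem_closedBall, sub_self, map_zero]; exact hε.le
  have hBcl : IsClosed B := by
    have : B = {z | p m (z - x₀) ≤ ε} := by ext z; rw [hBdef, Seminorm.mem_closedBall]; rfl
    rw [this]
    exact isClosed_le ((hp.continuous_seminorm m).comp (continuous_id.sub continuous_const))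
      continuous_const
  have hle : t₀ - r₀ ≤ t₀ + r₀ := by linarith
  set F : ℝ → X → X := fun t x => f (projIcc (t₀ - r₀) (t₀ + r₀) hle t, x) with hFdef
  have hF : ContinuousOn (fun z : ℝ × X => F z.1 z.2) (univ ×ˢ B) :=
    hf.comp ((continuous_subtype_val.comp (continuous_projIcc.comp continuous_fst)).prodMk
      continuous_snd).continuousOn fun z hz => ⟨(projIcc _ _ hle z.1).2, hBU hz.2⟩
  have hLip : ∀ k t, ∀ x ∈ B, ∀ y ∈ B, p k (F t x - F t y) ≤ c k * p k (x - y) :=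
    fun k t x hx y hy => hp.seminorm_sub_le_of_hasGateauxDerivAt hBconv
      (fun z hz => hDxf _ (projIcc _ _ hle t).2 z (hBU hz))
      (fun z hz u => hbound _ (projIcc _ _ hle t).2 z (hBU hz) u k) hx hy
  have hcont : ∀ z : ℝ → X, Continuous z → (∀ t, z t ∈ B) → Continuous fun s => F s (z s) :=
    fun z hz hzB => hF.comp_continuous (continuous_id.prodMk hz) fun t => ⟨mem_univ _, hzB t⟩
  obtain ⟨M, hM⟩ : ∃ M, ∀ t, p m (F t x₀) ≤ M := by
    have hcx : ContinuousOn (fun t => p m (f (t, x₀))) (Icc (t₀ - r₀) (t₀ + r₀)) :=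
      (hp.continuous_seminorm m).comp_continuousOn
        (hf.comp (by fun_prop) fun t ht => ⟨ht, hx₀⟩)
    obtain ⟨M, hM⟩ := (isCompact_Icc.image_of_continuousOn hcx).bddAbove
    exact ⟨M, fun t => hM (mem_image_of_mem _ (projIcc _ _ hle t).2)⟩
  have hM0 : 0 ≤ M := (apply_nonneg _ _).trans (hM t₀)
  have hFM : ∀ t, ∀ x ∈ B, p m (F t x) ≤ M + c m * ε := fun t x hx => by
    have h1 := map_add_le_add (p m) (F t x₀) (F t x - F t x₀)
    rw [add_sub_cancel] at h1
    have h2 := hLip m t x hx x₀ hx₀B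
    have h3 := mul_le_mul_of_nonneg_left ((p m).mem_closedBall.1 hx) (hc m)
    linarith [hM t]
  have hK : 0 ≤ M + c m * ε := add_nonneg hM0 (mul_nonneg (hc m) hε.le)
  -- The speed in `p m` is at most `M + c m * ε` on the ball, so in time `r` no curve leaves it; the
  -- `+ 1` keeps the denominator positive.
  set r := min r₀ (ε / (M + c m * ε + 1)) with hr
  have hr0 : 0 < r := lt_min hr₀ (by positivity)
  have hrr : r ≤ r₀ := min_le_left _ _
  have hKr : (M + c m * ε) * r ≤ ε := by
    have h1 : r ≤ ε / (M + c m * ε + 1) := min_le_right _ _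
    rw [le_div_iff₀ (by positivity)] at h1
    nlinarith
  obtain ⟨x, hxc, hxB, hx⟩ := hp.exists_eq_add_riemannIntegral hBcl hF hLip hx₀B (t₀ := t₀) hr0.le
    hc fun z hz hzB t ht => by
      rw [hBdef, Seminorm.mem_closedBall, add_sub_cancel_left]
      refine (hp.seminorm_riemannIntegral_le (hcont z hz hzB)
        fun s _ => hFM s _ (hzB s)).trans (le_trans ?_ hKr)
      exact mul_le_mul_of_nonneg_left
        (abs_le.2 ⟨by linarith [ht.1], by linarith [ht.2]⟩) hK
  have hFf : ∀ t ∈ Icc (t₀ - r) (t₀ + r), F t (x t) = f (t, x t) := fun t ht => by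
    rw [hFdef]
    beta_reduce
    rw [projIcc_of_mem hle ⟨by linarith [ht.1], by linarith [ht.2]⟩]
  refine ⟨r, hr0, hrr, x, fun t _ => hBU (hxB t), fun t ht => ?_, hxc.continuousOn,
    (hcont x hxc hxB).continuousOn.congr fun t ht => (hFf t ht).symm, ?_⟩
  · rw [← hFf t ht]
    exact hp.hasDerivWithinAt_of_eqOn_riemannIntegral (hcont x hxc hxB) hx ht
  · rw [hx t₀ ⟨by linarith, by linarith⟩]
    refine hp.eq_of_toCompletion fun k => ?_
    rw [map_add, hp.toCompletion_riemannIntegral (hcont x hxc hxB), intervalIntegral.integral_same,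
      add_zero]

theorem eq_zero_of_norm_deriv_le_mul_norm {Y : Type*} [NormedAddCommGroup Y] [NormedSpace ℝ Y]
    {g g' : ℝ → Y} {a b t₁ L : ℝ}
    (hg : ∀ t ∈ Icc a b, HasDerivWithinAt g (g' t) (Icc a b) t)
    (hbound : ∀ t ∈ Icc a b, ‖g' t‖ ≤ L * ‖g t‖) (ht₁ : t₁ ∈ Icc a b) (h₁ : g t₁ = 0) :
    ∀ t ∈ Icc a b, g t = 0 := by
  have key : ∀ {h h' : ℝ → Y} {a b : ℝ},
      (∀ t ∈ Icc a b, HasDerivWithinAt h (h' t) (Icc a b) t) →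
      (∀ t ∈ Icc a b, ‖h' t‖ ≤ L * ‖h t‖) → h a = 0 → ∀ t ∈ Icc a b, h t = 0 :=
    fun hh hb ha => eq_zero_of_abs_deriv_le_mul_abs_self_of_eq_zero_right
      (fun t ht => (hh t ht).continuousWithinAt)
      (fun t ht => (hh t ⟨ht.1, ht.2.le⟩).mono_of_mem_nhdsWithin (Icc_mem_nhdsGE_of_mem ht)) ha
      fun t ht => hb t ⟨ht.1, ht.2.le⟩
  intro t ht
  rcases le_total t₁ t with htt | htt
  · have hsub : Icc t₁ b ⊆ Icc a b := Icc_subset_Icc_left ht₁.1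
    exact key (fun s hs => (hg s (hsub hs)).mono hsub) (fun s hs => hbound s (hsub hs)) h₁ t
      ⟨htt, ht.2⟩
  -- Times before `t₁` reduce to the forward case by reflecting time.
  · have hsub : ∀ s ∈ Icc (-t₁) (-a), -s ∈ Icc a b := fun s hs =>
      ⟨by linarith [hs.2], by linarith [hs.1, ht₁.2]⟩
    have := key (h := fun s => g (-s)) (h' := fun s => -g' (-s)) (a := -t₁) (b := -a)
      (fun s hs => by
        simpa [Function.comp_def] using (hg (-s) (hsub s hs)).scomp s (hasDerivAt_neg s).hasDerivWithinAt hsub)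
      (fun s hs => by rw [norm_neg]; exact hbound _ (hsub s hs)) (by simpa using h₁) (-t)
      ⟨by linarith, by linarith [ht.1]⟩
    simpa using this

theorem IsGradedFrechet.eqOn_of_isC1Solution (hX : IsGradedFrechet p) {U : Set X} (hU : IsOpen U)
    {x₀ : X} {t₀ r : ℝ} (hr : 0 ≤ r) {f : ℝ × X → X} {Dxf : ℝ → X → X →L[ℝ] X}
    (hDxf : ∀ t ∈ Icc (t₀ - r) (t₀ + r), ∀ x ∈ U,
      HasGateauxDerivAt (fun y => f (t, y)) (Dxf t x) x)
    {c : ℕ → ℝ}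
    (hbound : ∀ t ∈ Icc (t₀ - r) (t₀ + r), ∀ x ∈ U, ∀ (u : X) (k : ℕ),
      p k (Dxf t x u) ≤ c k * p k u)
    {x y : ℝ → X} (hx : IsC1Solution f U t₀ x₀ r x) (hy : IsC1Solution f U t₀ x₀ r y) :
    EqOn x y (Icc (t₀ - r) (t₀ + r)) := by
  have hp := hX.withSeminorms
  have := hX.t2
  set J := Icc (t₀ - r) (t₀ + r)
  have hlocal : ∀ t₁ ∈ J, x t₁ = y t₁ → ∃ δ > 0, ∀ t ∈ J, |t - t₁| ≤ δ → x t = y t := by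
    intro t₁ ht₁ h₁
    obtain ⟨m, ε, hε, hBU⟩ := hX.exists_closedBall_subset (hU.mem_nhds (hx.mem t₁ ht₁))
    have hBn : (p m).closedBall (x t₁) ε ∈ 𝓝 (x t₁) := by
      filter_upwards [(hp.tendsto_nhds id (x t₁)).1 tendsto_id m ε hε] with z hz
      exact (p m).mem_closedBall.2 hz.le
    have hev := inter_mem (mem_map.1 (hx.continuousOn t₁ ht₁ hBn))
      (mem_map.1 (hy.continuousOn t₁ ht₁
        (show (p m).closedBall (x t₁) ε ∈ 𝓝 (y t₁) from h₁ ▸ hBn)))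
    obtain ⟨δ, hδ, hball⟩ := Metric.mem_nhdsWithin_iff.1 hev
    refine ⟨δ / 2, by positivity, fun t ht htt => hp.eq_of_toCompletion fun k => ?_⟩
    -- This is `J ∩ [t₁ - δ / 2, t₁ + δ / 2]` written as one interval; both solutions stay in a
    -- common ball on it.
    set I := Icc (max (t₀ - r) (t₁ - δ / 2)) (min (t₀ + r) (t₁ + δ / 2))
    have hmemI : ∀ s, s ∈ I ↔ s ∈ J ∧ |s - t₁| ≤ δ / 2 := fun s => by
      simp only [I, J, mem_Icc, max_le_iff, le_min_iff, abs_le]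
      constructor
      · rintro ⟨⟨h1, h2⟩, h3, h4⟩; exact ⟨⟨h1, h3⟩, by linarith, by linarith⟩
      · rintro ⟨⟨h1, h2⟩, h3, h4⟩; exact ⟨⟨h1, by linarith⟩, h2, by linarith⟩
    have hIJ : I ⊆ J := fun s hs => ((hmemI s).1 hs).1
    have hIB : ∀ s ∈ I, x s ∈ (p m).closedBall (x t₁) ε ∧ y s ∈ (p m).closedBall (x t₁) ε :=
      fun s hs => hball ⟨by
        rw [Metric.mem_ball, Real.dist_eq]
        linarith [((hmemI s).1 hs).2], hIJ hs⟩
    have hderiv : ∀ {z : ℝ → X}, IsC1Solution f U t₀ x₀ r z → ∀ s ∈ I, HasDerivWithinAt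
        (fun s => hp.toCompletion k (z s)) (hp.toCompletion k (f (s, z s))) I s :=
      fun hz s hs => HasDerivWithinAt.mono
        ((hp.toCompletion k).hasDerivAtFilter_comp (hz.hasDeriv s (hIJ hs))) hIJ
    have hzero := eq_zero_of_norm_deriv_le_mul_norm (L := c k) (t₁ := t₁)
      (g := fun s => hp.toCompletion k (x s) - hp.toCompletion k (y s))
      (g' := fun s => hp.toCompletion k (f (s, x s)) - hp.toCompletion k (f (s, y s)))
      (fun s hs => (hderiv hx s hs).sub (hderiv hy s hs))
      (fun s hs => by
        rw [← map_sub, ← map_sub, hp.norm_toCompletion, hp.norm_toCompletion]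
        exact hp.seminorm_sub_le_of_hasGateauxDerivAt (f := fun z => f (s, z))
          (Seminorm.convex_closedBall _ _ _)
          (fun z hz => hDxf s (hIJ hs) z (hBU hz))
          (fun z hz u => hbound s (hIJ hs) z (hBU hz) u k) (hIB s hs).1 (hIB s hs).2)
      ((hmemI t₁).2 ⟨ht₁, by simpa using by positivity⟩) (by simp [h₁]) t ((hmemI t).2 ⟨ht, htt⟩)
    exact sub_eq_zero.1 hzero
  have : PreconnectedSpace J := isPreconnected_iff_preconnectedSpace.1 isPreconnected_Icc
  -- The coincidence set is closed by continuity, open by `hlocal`, and contains `t₀`.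
  have hclopen : IsClopen {t : J | x t = y t} := by
    refine ⟨isClosed_eq (continuousOn_iff_continuous_domRestrict.1 hx.continuousOn)
      (continuousOn_iff_continuous_domRestrict.1 hy.continuousOn), Metric.isOpen_iff.2 ?_⟩
    intro t₁ h₁
    obtain ⟨δ, hδ, h⟩ := hlocal t₁ t₁.2 h₁
    exact ⟨δ, hδ, fun t ht => h t t.2 (Metric.mem_ball.1 ht).le⟩
  have huniv := hclopen.eq_univ
    ⟨⟨t₀, by linarith, by linarith⟩, hx.initial.trans hy.initial.symm⟩
  exact fun t ht => eq_univ_iff_forall.1 huniv ⟨t, ht⟩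

end ODE

theorem theorem4p1 {X : Type*} [AddCommGroup X] [Module ℝ X] [UniformSpace X]
    [IsUniformAddGroup X] [ContinuousSMul ℝ X]
    (p : ℕ → Seminorm ℝ X) (_hX : IsGradedFrechet p)
    (_hstd : IsStandard p) (_hstdC : IsStandard (fun k => pathSeminorm (p k)))
    (U : Set X) (_hU : IsOpen U) (x₀ : X) (_hx₀ : x₀ ∈ U)
    (t₀ r₀ : ℝ) (_hr₀ : 0 < r₀)
    (f : ℝ × X → X) (_hf : ContinuousOn f (Icc (t₀ - r₀) (t₀ + r₀) ×ˢ U))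
    (Dxf : ℝ → X → X →L[ℝ] X)
    (_hDxf : ∀ t ∈ Icc (t₀ - r₀) (t₀ + r₀), ∀ x ∈ U,
      HasGateauxDerivAt (fun y => f (t, y)) (Dxf t x) x)
    (c : ℕ → ℝ) (_hc_mono : Monotone c) (_hc_nonneg : ∀ k, 0 ≤ c k)
    (_hbound : ∀ t ∈ Icc (t₀ - r₀) (t₀ + r₀), ∀ x ∈ U, ∀ (u : X) (k : ℕ),
      p k (Dxf t x u) ≤ c k * p k u) :
    (∃ r : ℝ, 0 < r ∧ r ≤ r₀ ∧ ∃ x : ℝ → X, IsC1Solution f U t₀ x₀ r x) ∧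
    (∀ Df : ℝ × X → ℝ × X →L[ℝ] X,
      IsC1On f Df (Icc (t₀ - r₀) (t₀ + r₀) ×ˢ U) →
      (∀ t ∈ Icc (t₀ - r₀) (t₀ + r₀), ∀ x ∈ U, ∀ (τ : ℝ) (u : X) (k : ℕ),
        p k (Df (t, x) (τ, u)) ≤ c k * (|τ| + p k u)) →
      ∀ r : ℝ, 0 < r → r ≤ r₀ → ∀ x y : ℝ → X,
        IsC1Solution f U t₀ x₀ r x → IsC1Solution f U t₀ x₀ r y →
        EqOn x y (Icc (t₀ - r) (t₀ + r))) := by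
  refine ⟨_hX.exists_isC1Solution _hU _hx₀ _hr₀ _hf _hDxf _hc_nonneg _hbound,
    fun _ _ _ r hr hrr x y hx hy => ?_⟩
  have hsub : Icc (t₀ - r) (t₀ + r) ⊆ Icc (t₀ - r₀) (t₀ + r₀) :=
    Icc_subset_Icc (by linarith) (by linarith)
  exact _hX.eqOn_of_isC1Solution _hU hr.le (fun t ht => _hDxf t (hsub ht))
    (fun t ht => _hbound t (hsub ht)) hx hy
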